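/- Let $0<\lambda<\mu$ and consider an M/M/1 FIFO queue with arrival rate $\lambda$ and service rate $\mu$: the inter-arrival times $\tau_0,\tau_1,\dots$ are $\mathrm{Exp}(\lambda)$, the service times $\sigma_0,\sigma_1,\dots$ are $\mathrm{Exp}(\mu)$, and all these variables are independent. Let $B$ be a generic busy period, that is, the maximal time interval of positive queue length which starts when customer $0$ arrives at time $0$ in an empty system; customer $k$ arrives at time $\tau_0+\dots+\tau_{k-1}$ and has service time $\sigma_k$. Let $|B|$ be the number of customers served during $B$. For $n\ge 0$ let $\mathcal D_n$ be the set of Dyck paths of length $2n$, i.e. of the lattice paths from $(0,0)$ to $(2n,0)$ with steps $(1,1)$ and $(1,-1)$ that never go below the axis $y=0$, and let $C_n=\frac1{n+1}\binom{2n}{n}$ be its cardinality. For $\pi\in\mathcal D_n$ and $0\le j\le n-1$ let $\alpha_j(\pi)$ be the number of steps of $\pi$ contained in the line $y=x-2j$ (equivalently, $\alpha_j(\pi)+1$ lattice points of $\pi$ lie on this line), and put $$R_n(y_0,\dots,y_{n-1})=\sum_{\pi\in\mathcal D_n}\prod_{i=0}^{n-1}y_i^{\alpha_i(\pi)} .$$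 Let $(\tilde\sigma_0,\dots,\tilde\sigma_n)$ be a random vector distributed according to the conditional law of $(\sigma_0,\dots,\sigma_n)$ given $|B|=n+1$. Then for all $s_0,\dots,s_n\in\mathbb C$ with $\mathrm{Re}(s_i)\ge 0$, $\prod_{i=0}^n e^{-s_i\tilde\sigma_i}$ is integrable and $$\mathbb E\Big[\prod_{i=0}^n e^{-s_i\tilde\sigma_i}\Big]=\frac1{C_n}\Big(\prod_{i=0}^{n-1}z_i\Big)R_n(z_0,\dots,z_{n-1})\,z_n,\qquad z_i=\frac{\lambda+\mu}{\lambda+\mu+s_i}.$$ Equivalently, $(\tilde\sigma_0,\dots,\tilde\sigma_n)$ has the following law: choose $\Pi$ uniformly in $\mathcal D_n$; given $\Pi=\pi$, the components are independent, for $j<n$ the $j$-th one is distributed as the sum of $\alpha_j(\pi)+1$ independent $\mathrm{Exp}(\lambda+\mu)$ variables, and the $n$-th one is $\mathrm{Exp}(\lambda+\mu)$. -/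

import Mathlib

open MeasureTheory ProbabilityTheory

namespace MM1

/-! ### The single-server FIFO queue on `[0, ∞)`

A sample path is given by the inter-arrival times `τ` and the service times `σ`.  Customer `0`
arrives at time `0` in an empty system and so opens a busy period. -/

/-- Arrival time of customer `k`: `A 0 = 0` and `τ k = A (k + 1) - A k`. -/
def arrival (τ : ℕ → ℝ) (k : ℕ) : ℝ := ∑ i ∈ Finset.range k, τ i

/-- Time at which the service of customer `k` begins (first in, first out): the customer waits
until the previous one has left. -/
noncomputable def serviceStart (τ σ : ℕ → ℝ) : ℕ → ℝ
  | 0 => arrival τ 0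
  | k + 1 => max (arrival τ (k + 1)) (serviceStart τ σ k + σ k)

/-- Departure time of customer `k`. -/
noncomputable def departure (τ σ : ℕ → ℝ) (k : ℕ) : ℝ := serviceStart τ σ k + σ k

/-- Queue length at time `t`: the number of customers in service or in the buffer. -/
noncomputable def queueLength (τ σ : ℕ → ℝ) (t : ℝ) : ℕ∞ :=
  Set.encard {k : ℕ | arrival τ k ≤ t ∧ t < departure τ σ k}

/-- The busy period opened by customer `0`: the maximal time interval containing the instant
`A 0 = 0` on which the queue length is positive. -/
def busyPeriod (τ σ : ℕ → ℝ) : Set ℝ :=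
  Set.ordConnectedComponent {t : ℝ | 0 < queueLength τ σ t} (arrival τ 0)

/-- The length `|B|` of the busy period: the number of customers served during it. -/
noncomputable def busyLength (τ σ : ℕ → ℝ) : ℕ∞ :=
  Set.encard {k : ℕ | Set.Ico (serviceStart τ σ k) (departure τ σ k) ⊆ busyPeriod τ σ}

/-- The conditional law of `(σ 0, …, σ n)` given `|B| = n + 1`. -/
noncomputable def serviceLaw {Ω : Type*} [MeasurableSpace Ω] (P : Measure Ω)
    (τ σ : ℕ → Ω → ℝ) (n : ℕ) : Measure (Fin (n + 1) → ℝ) :=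
  (cond P {ω | busyLength (fun k => τ k ω) (fun k => σ k ω) = ((n + 1 : ℕ) : ℕ∞)}).map
    (fun ω (i : Fin (n + 1)) => σ i ω)

/-- The law of the sum of `k` independent random variables of law `Exp(r)`. -/
noncomputable def expSumLaw (r : ℝ) (k : ℕ) : Measure ℝ :=
  (Measure.pi (fun _ : Fin k => expMeasure r)).map (fun x => ∑ i, x i)

/-! ### Dyck paths and their polynomials -/

/-- The Dyck paths of length `2 * n`. -/
abbrev DyckPath (n : ℕ) : Type := {p : DyckWord // p.semilength = n}

/-- The ordinate of the path at abscissa `k`, steps being `(1, 1)` for `U` and `(1, -1)` for `D`. -/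
def height {n : ℕ} (π : DyckPath n) (k : ℕ) : ℤ :=
  ((π.1.toList.take k).count DyckStep.U : ℤ) - ((π.1.toList.take k).count DyckStep.D : ℤ)

/-- The lattice point of the path at abscissa `k` is on the line `y = x - 2 * j`. -/
def OnLine {n : ℕ} (π : DyckPath n) (j k : ℕ) : Prop := height π k = (k : ℤ) - 2 * (j : ℤ)

instance {n : ℕ} (π : DyckPath n) (j k : ℕ) : Decidable (OnLine π j k) := by
  unfold OnLine; infer_instance

/-- The length of the intersection of the path with the line `y = x - 2 * j`, that is, the number
of steps of the path both of whose ends are on that line. -/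
def alpha {n : ℕ} (π : DyckPath n) (j : ℕ) : ℕ :=
  ((Finset.range (2 * n)).filter (fun k => OnLine π j k ∧ OnLine π j (k + 1))).card

/-- The polynomial `R_n(y_0, …, y_{n-1})`, the sum over Dyck paths of `∏ y_i ^ α_i`. -/
noncomputable def dyckR (n : ℕ) : MvPolynomial (Fin n) ℂ :=
  ∑ π : DyckPath n, ∏ i : Fin n, MvPolynomial.X i ^ alpha π i

/-- The number of exponential summands of each of the services `0, …, n`, for a given Dyck path:
`α_j + 1` for `j < n`, and `1` for `j = n`. -/
def numExp {n : ℕ} (π : DyckPath n) : Fin (n + 1) → ℕ :=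
  Fin.snoc (α := fun _ => ℕ) (fun j : Fin n => alpha π j + 1) 1

end MM1

/-! While the busy period lasts the server never idles, so departures are the partial sums of the
services. The period ends with customer `n` exactly when customers `1, …, n` each arrive by the
preceding departure and customer `n + 1` does not (`busyLength_eq_iff`). Let `r_j` be the number of
arrivals during service `j`. Almost surely this says that `r_0 + … + r_{j-1} ≥ j` for `j ≤ n`, with
total `n`: the `r_j` are the up-run lengths of a Dyck path, and `r_j = α_j` for `j < n`, `r_n = 0`.

Given the services `x`, the Poisson arrivals give this event probability `λ^n e^{-λ ∑ x_j} ∑_r ∏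
x_j^{r_j} / r_j!` (`pi_endsAtRec`). The proof avoids the Poisson process by induction on the first
arrival `t`: merging the remainder `x_0 - t` into `x_1` removes one customer, and integrating over
`t` undoes the merging of the first two runs (`sum_runSeqs_succ`, `integral_sum_runWeight`).

Multiplying by the densities `μ e^{-μ x_j}` separates the coordinates of each path's term into
Erlang laws of shape `r_j + 1` and rate `λ + μ`. The constant is the same for all paths because `∑
r_j = n`, so the path is uniform after conditioning (`withDensity_endsAtRec`, `serviceLaw_eq`). The
Laplace transform is then an average of products. -/

namespace MM1

/-! ### Dyck paths as sequences of run lengths -/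

section Runs

open DyckStep

/-- The numbers of up steps before the first down step, between consecutive down steps, and after
the last down step. -/
def runs : List DyckStep → List ℕ
  | [] => [0]
  | U :: l => (runs l).modifyHead (· + 1)
  | D :: l => 0 :: runs l

/-- The lattice path with given run lengths. -/
def ofRuns : List ℕ → List DyckStep
  | [] => []
  | [a] => List.replicate a U
  | a :: b :: r => List.replicate a U ++ D :: ofRuns (b :: r)

lemma runs_eq_cons (l : List DyckStep) : ∃ a r, runs l = a :: r := by
  induction l with
  | nil => exact ⟨0, [], rfl⟩
  | cons s l ih =>
    obtain ⟨a, r, h⟩ := ih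
    cases s
    · exact ⟨a + 1, r, by simp [runs, h]⟩
    · exact ⟨0, a :: r, by simp [runs, h]⟩

lemma runs_replicate_append (a : ℕ) (l : List DyckStep) :
    runs (List.replicate a U ++ l) = (runs l).modifyHead (· + a) := by
  induction a with
  | zero =>
    obtain ⟨b, r, h⟩ := runs_eq_cons l
    simp [h]
  | succ a ih =>
    obtain ⟨b, r, h⟩ := runs_eq_cons l
    simp [List.replicate_succ, runs, ih, h, add_assoc]

lemma runs_ofRuns (a : ℕ) (r : List ℕ) : runs (ofRuns (a :: r)) = a :: r := by
  induction r generalizing a with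
  | nil =>
    have := runs_replicate_append a []
    simpa [runs, ofRuns] using this
  | cons b r ih => simp [ofRuns, runs_replicate_append, runs, ih]

lemma ofRuns_succ_cons (a : ℕ) (r : List ℕ) : ofRuns ((a + 1) :: r) = U :: ofRuns (a :: r) := by
  cases r <;> simp [ofRuns, List.replicate_succ]

lemma ofRuns_runs (l : List DyckStep) : ofRuns (runs l) = l := by
  induction l with
  | nil => rfl
  | cons s l ih =>
    obtain ⟨a, r, h⟩ := runs_eq_cons l
    cases s
    · rw [h] at ih
      simp [runs, h, ofRuns_succ_cons, ih]
    · rw [h] at ih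
      simp [runs, h, ofRuns, ih]

lemma length_runs (l : List DyckStep) : (runs l).length = l.count D + 1 := by
  induction l with
  | nil => rfl
  | cons s l ih => cases s <;> simp [runs, ih]

lemma sum_runs (l : List DyckStep) : (runs l).sum = l.count U := by
  induction l with
  | nil => rfl
  | cons s l ih =>
    obtain ⟨a, r, h⟩ := runs_eq_cons l
    rw [h] at ih
    cases s
    · simp only [runs, h, List.modifyHead_cons, List.sum_cons, List.count_cons_self] at ih ⊢
      omega
    · simp [runs, h, ← ih]

/-- New minima of a path can occur only right after a down step, and the `j`-th down step is
preceded by the first `j` runs. The starting height `h` is free so that the induction can absorb the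
first step. -/
lemma runs_ballot_iff (l : List DyckStep) (h : ℕ) :
    (∀ i, (l.take i).count D ≤ h + (l.take i).count U) ↔
      ∀ j < (runs l).length, j ≤ h + ((runs l).take j).sum := by
  induction l generalizing h with
  | nil => simp [runs]
  | cons s l ih =>
    obtain ⟨a, r, hr⟩ := runs_eq_cons l
    cases s
    · have h1 := ih (h + 1)
      rw [hr] at h1
      have h2 : (∀ i, ((U :: l).take i).count D ≤ h + ((U :: l).take i).count U) ↔
          ∀ i, (l.take i).count D ≤ h + 1 + (l.take i).count U := by
        constructor
        · intro H i
          have := H (i + 1)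
          simp at this
          omega
        · rintro H (_ | i)
          · simp
          · have := H i
            simp
            omega
      rw [h2, h1]
      simp only [runs, hr, List.modifyHead_cons, List.length_cons]
      constructor
      · rintro H (_ | j) hj
        · simp
        · have := H (j + 1) hj
          simp at this ⊢
          omega
      · rintro H (_ | j) hj
        · simp
        · have := H (j + 1) hj
          simp at this ⊢
          omega
    -- An initial down step forces `1 ≤ h`, so the truncated `h - 1` is a genuine subtraction.
    · have h2 : (∀ i, ((D :: l).take i).count D ≤ h + ((D :: l).take i).count U) ↔
          1 ≤ h ∧ ∀ i, (l.take i).count D ≤ (h - 1) + (l.take i).count U := by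
        constructor
        · intro H
          have h0 := H 1
          simp at h0
          refine ⟨by omega, fun i => ?_⟩
          have := H (i + 1)
          simp at this
          omega
        · rintro ⟨h0, H⟩ (_ | i)
          · simp
          · have := H i
            simp
            omega
      rw [h2, ih]
      simp only [runs, List.length_cons]
      constructor
      · rintro ⟨h0, H⟩ (_ | j) hj
        · simp
        · have := H j (by omega)
          simp
          omega
      · intro H
        have h0 := H 1 (by simp [hr])
        simp at h0
        refine ⟨by omega, fun j hj => ?_⟩
        have := H (j + 1) (by omega)
        simp at this
        omega

/-- The number of steps of a lattice path following exactly `j` down steps and not going down. -/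
lemma card_flat_steps (l : List DyckStep) (j : ℕ) :
    ((Finset.range l.length).filter
      (fun k => (l.take k).count D = j ∧ (l.take (k + 1)).count D = j)).card
      = (runs l).getD j 0 := by
  induction l generalizing j with
  | nil => cases j <;> simp [runs]
  | cons s l ih =>
    obtain ⟨a, r, hr⟩ := runs_eq_cons l
    rw [Finset.card_filter, List.length_cons, Finset.sum_range_succ']
    cases s
    · have := ih j
      rw [Finset.card_filter] at this
      simp only [List.take_succ_cons, List.count_cons_of_ne (show U ≠ D by decide), this]
      cases j <;> simp [runs, hr]
    · cases j with
      | zero => simp [runs]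
      | succ j =>
        have := ih j
        rw [Finset.card_filter] at this
        simp [runs, this]

/-- After `k` steps the height is `k` minus twice the number of down steps. The bound on `k`
matters: beyond the end of the path `take` no longer has `k` steps. -/
lemma onLine_iff {n : ℕ} (π : DyckPath n) (j k : ℕ) (hk : k ≤ 2 * n) :
    OnLine π j k ↔ (π.1.toList.take k).count D = j := by
  have h1 : k ≤ π.1.toList.length := by
    rw [← π.1.two_mul_semilength_eq_length, π.2]; exact hk
  have h2 : ∀ l : List DyckStep, l.count U + l.count D = l.length := by
    intro l
    induction l with
    | nil => rfl
    | cons s l ih => cases s <;> simp <;> omega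
  have h3 := h2 (π.1.toList.take k)
  rw [List.length_take, min_eq_left h1] at h3
  unfold OnLine height
  omega

lemma alpha_eq_getD_runs {n : ℕ} (π : DyckPath n) (j : ℕ) :
    alpha π j = (runs π.1.toList).getD j 0 := by
  rw [← card_flat_steps, ← π.1.two_mul_semilength_eq_length, π.2, alpha]
  congr 1
  refine Finset.filter_congr fun k hk => ?_
  rw [Finset.mem_range] at hk
  rw [onLine_iff π j k (by omega), onLine_iff π j (k + 1) (by omega)]

/-- The run lengths of the Dyck paths of length `2 * n`. -/
def runSeqs (n : ℕ) : Finset (List ℕ) := Finset.univ.image fun π : DyckPath n => runs π.1.toList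

lemma mem_runSeqs {n : ℕ} {r : List ℕ} :
    r ∈ runSeqs n ↔ r.length = n + 1 ∧ r.sum = n ∧ ∀ j < n + 1, j ≤ (r.take j).sum := by
  simp only [runSeqs, Finset.mem_image, Finset.mem_univ, true_and]
  constructor
  · rintro ⟨π, rfl⟩
    have hl : (runs π.1.toList).length = n + 1 := by
      rw [length_runs, ← π.1.semilength_eq_count_D, π.2]
    refine ⟨hl, by rw [sum_runs]; exact π.2, ?_⟩
    have := (runs_ballot_iff π.1.toList 0).1 (by simpa using π.1.count_D_le_count_U)
    rw [hl] at this
    simpa using this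
  · rintro ⟨h1, h2, h3⟩
    obtain ⟨a, r, rfl⟩ : ∃ a r', r = a :: r' := List.exists_cons_of_length_eq_add_one h1
    have hr := runs_ofRuns a r
    have hU := sum_runs (ofRuns (a :: r))
    have hD := length_runs (ofRuns (a :: r))
    rw [hr] at hU hD
    refine ⟨⟨⟨ofRuns (a :: r), by omega, ?_⟩, ?_⟩, hr⟩
    · have := (runs_ballot_iff (ofRuns (a :: r)) 0).2 (by rw [hr, h1]; simpa using h3)
      simpa using this
    · show (ofRuns (a :: r)).count U = n
      omega

lemma sum_runSeqs {M : Type*} [AddCommMonoid M] (n : ℕ) (f : List ℕ → M) :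
    ∑ r ∈ runSeqs n, f r = ∑ π : DyckPath n, f (runs π.1.toList) := by
  refine Finset.sum_image fun π _ π' _ h => ?_
  have := congrArg ofRuns h
  simp only [ofRuns_runs] at this
  exact Subtype.ext (DyckWord.ext this)

/-- Deleting one up step of the first run and the first down step merges the first two runs into
one. The fibre over a shorter path with first run `c` consists of the splittings `c = a + b`; this
mirrors `mergeService`. -/
lemma sum_runSeqs_succ {M : Type*} [AddCommMonoid M] (n : ℕ) (f : List ℕ → M) :
    ∑ r ∈ runSeqs (n + 1), f r =
      ∑ r ∈ runSeqs n, ∑ p ∈ Finset.HasAntidiagonal.antidiagonal (r.headD 0),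
        f ((p.1 + 1) :: p.2 :: r.tail) := by
  rw [Finset.sum_sigma']
  symm
  refine Finset.sum_bij' (fun x _ => (x.2.1 + 1) :: x.2.2 :: x.1.tail)
    (fun r _ => ⟨(r.headD 0 - 1 + r.tail.headD 0) :: r.tail.tail, (r.headD 0 - 1, r.tail.headD 0)⟩)
    ?_ ?_ ?_ ?_ ?_
  · rintro ⟨r, a, b⟩ h
    simp only [Finset.mem_sigma, mem_runSeqs, Finset.HasAntidiagonal.mem_antidiagonal] at h
    obtain ⟨⟨h1, h2, h3⟩, h4⟩ := h
    obtain ⟨c, r, rfl⟩ : ∃ a r', r = a :: r' := List.exists_cons_of_length_eq_add_one h1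
    simp only [List.headD_cons] at h4
    simp only [List.length_cons, List.sum_cons] at h1 h2
    refine mem_runSeqs.2 ⟨by simp; omega, by simp; omega, ?_⟩
    rintro (_ | _ | j) hj
    · simp
    · simp
    · have := h3 (j + 1) (by omega)
      simp at this ⊢
      omega
  · intro r h
    rw [mem_runSeqs] at h
    obtain ⟨h1, h2, h3⟩ := h
    obtain ⟨a, r, rfl⟩ : ∃ a r', r = a :: r' := List.exists_cons_of_length_eq_add_one h1
    simp only [List.length_cons, Nat.add_right_cancel_iff] at h1
    obtain ⟨b, r, rfl⟩ : ∃ a r', r = a :: r' := List.exists_cons_of_length_eq_add_one h1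
    -- The ballot condition at `1` makes the first run nonempty, so `headD 0 - 1` truncates nothing.
    have ha := h3 1 (by omega)
    simp only [List.length_cons, List.sum_cons, List.take_succ_cons, List.take_zero,
      List.sum_nil] at h1 h2 ha
    simp only [Finset.mem_sigma, mem_runSeqs, Finset.HasAntidiagonal.mem_antidiagonal]
    refine ⟨⟨by simp; omega, by simp; omega, ?_⟩, by simp⟩
    rintro (_ | j) hj
    · simp
    · have := h3 (j + 2) (by omega)
      simp at this ⊢
      omega
  · rintro ⟨r, a, b⟩ h
    simp only [Finset.mem_sigma, mem_runSeqs, Finset.HasAntidiagonal.mem_antidiagonal] at h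
    obtain ⟨⟨h1, h2, h3⟩, h4⟩ := h
    obtain ⟨c, r, rfl⟩ : ∃ a r', r = a :: r' := List.exists_cons_of_length_eq_add_one h1
    simp only [List.headD_cons] at h4
    simp [h4]
  · intro r h
    rw [mem_runSeqs] at h
    obtain ⟨h1, h2, h3⟩ := h
    obtain ⟨a, r, rfl⟩ : ∃ a r', r = a :: r' := List.exists_cons_of_length_eq_add_one h1
    simp only [List.length_cons, Nat.add_right_cancel_iff] at h1
    obtain ⟨b, r, rfl⟩ : ∃ a r', r = a :: r' := List.exists_cons_of_length_eq_add_one h1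
    have ha := h3 1 (by omega)
    simp at ha ⊢
    omega
  · intros; rfl

lemma runSeqs_zero : runSeqs 0 = {[0]} := by
  ext r
  rw [mem_runSeqs, Finset.mem_singleton]
  constructor
  · rintro ⟨h1, h2, -⟩
    obtain ⟨a, rfl⟩ := List.length_eq_one_iff.1 h1
    simpa using h2
  · rintro rfl
    simp

/-- The last run is empty, since the first `n` runs already contain all `n` up steps; hence the
separate value `1` at index `n` obeys the same formula. -/
lemma numExp_eq {n : ℕ} (π : DyckPath n) (j : Fin (n + 1)) :
    numExp π j = (runs π.1.toList).getD j 0 + 1 := by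
  induction j using Fin.lastCases with
  | cast j => simp [numExp, alpha_eq_getD_runs]
  | last =>
    obtain ⟨h1, h2, h3⟩ := mem_runSeqs.1 (Finset.mem_image_of_mem _ (Finset.mem_univ π))
    have h4 := h3 n (by omega)
    have h5 := List.sum_take_succ (runs π.1.toList) n (by omega)
    rw [List.take_of_length_le (by omega), h2] at h5
    have h6 : (runs π.1.toList)[n]'(by omega) = 0 := by omega
    rw [Fin.val_last, List.getD_eq_getElem _ _ (show n < (runs π.1.toList).length by omega), h6]
    simp [numExp]

lemma card_dyckPath (n : ℕ) : Fintype.card (DyckPath n) = catalan n :=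
  DyckWord.card_dyckWord_semilength_eq_catalan n

end Runs

end MM1

namespace MM1

/-! ### Sample paths of the queue -/

section SamplePath

variable {τ σ : ℕ → ℝ}

lemma arrival_succ (τ : ℕ → ℝ) (k : ℕ) : arrival τ (k + 1) = arrival τ k + τ k :=
  Finset.sum_range_succ _ _

lemma arrival_mono (hτ : ∀ k, 0 < τ k) : Monotone (arrival τ) :=
  monotone_nat_of_le_succ fun k => by rw [arrival_succ]; linarith [hτ k]

/-- The busy period opened by customer `0` ends with the service of customer `n`: customers
`1, …, n` arrive before the end of the preceding service, and customer `n + 1` does not. -/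
def EndsAt (τ σ : ℕ → ℝ) (n : ℕ) : Prop :=
  (∀ k < n, arrival τ (k + 1) ≤ arrival σ (k + 1)) ∧ arrival σ (n + 1) < arrival τ (n + 1)

lemma arrival_le_serviceStart (τ σ : ℕ → ℝ) (k : ℕ) : arrival τ k ≤ serviceStart τ σ k := by
  cases k
  · exact le_rfl
  · exact le_max_left _ _

/-- With every customer arriving before the previous departure there is no idle time, and each
maximum is attained by that departure. -/
lemma serviceStart_eq {k : ℕ} (h : ∀ j < k, arrival τ (j + 1) ≤ arrival σ (j + 1)) :
    serviceStart τ σ k = arrival σ k := by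
  induction k with
  | zero => simp [serviceStart, arrival]
  | succ k ih =>
    rw [serviceStart, ih fun j hj => h j (by omega), ← arrival_succ]
    exact max_eq_right (h k (by omega))

lemma departure_eq {k : ℕ} (h : ∀ j < k, arrival τ (j + 1) ≤ arrival σ (j + 1)) :
    departure τ σ k = arrival σ (k + 1) := by
  rw [departure, serviceStart_eq h, arrival_succ]

lemma queueLength_pos {k : ℕ} (h : ∀ j < k, arrival τ (j + 1) ≤ arrival σ (j + 1)) {t : ℝ}
    (h0 : 0 ≤ t) (ht : t < arrival σ (k + 1)) : 0 < queueLength τ σ t := by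
  induction k with
  | zero =>
    refine Set.encard_pos.2 ⟨0, ?_, ?_⟩
    · simpa [arrival] using h0
    · rwa [departure_eq h]
  | succ k ih =>
    rcases lt_or_ge t (arrival σ (k + 1)) with h1 | h1
    · exact ih (fun j hj => h j (by omega)) h1
    · refine Set.encard_pos.2 ⟨k + 1, ?_, by rwa [departure_eq h]⟩
      exact (arrival_le_serviceStart τ σ _).trans ((serviceStart_eq h).trans_le h1)

lemma service_subset_busyPeriod (hσ : ∀ k, 0 < σ k) {k : ℕ}
    (h : ∀ j < k, arrival τ (j + 1) ≤ arrival σ (j + 1)) :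
    Set.Ico (serviceStart τ σ k) (departure τ σ k) ⊆ busyPeriod τ σ := by
  intro y hy
  rw [departure_eq h, serviceStart_eq h] at hy
  have h0 : (0 : ℝ) ≤ arrival σ k := Finset.sum_nonneg fun i _ => (hσ i).le
  have hA : arrival τ 0 = 0 := by simp [arrival]
  rw [busyPeriod, Set.mem_ordConnectedComponent, hA, Set.uIcc_of_le (h0.trans hy.1)]
  exact fun t ht => queueLength_pos h ht.1 (ht.2.trans_lt hy.2)

/-- The interval from `0` to a later service start contains the instant `arrival σ (n + 1)`, when
customers up to `n` have left and no other has arrived. -/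
lemma not_service_subset_busyPeriod (hτ : ∀ k, 0 < τ k) (hσ : ∀ k, 0 < σ k) {n m : ℕ}
    (h : EndsAt τ σ n) (hm : n < m) :
    ¬ Set.Ico (serviceStart τ σ m) (departure τ σ m) ⊆ busyPeriod τ σ := by
  intro H
  have hA : arrival τ 0 = 0 := by simp [arrival]
  have hs := H (show serviceStart τ σ m ∈ _ from ⟨le_rfl, lt_add_of_pos_right _ (hσ m)⟩)
  have h0 : (0 : ℝ) ≤ arrival σ (n + 1) := Finset.sum_nonneg fun i _ => (hσ i).le
  have h1 : arrival σ (n + 1) ≤ serviceStart τ σ m :=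
    (h.2.le.trans (arrival_mono hτ hm)).trans (arrival_le_serviceStart τ σ m)
  rw [busyPeriod, Set.mem_ordConnectedComponent, hA, Set.uIcc_of_le (h0.trans h1)] at hs
  obtain ⟨j, hj1, hj2⟩ := Set.encard_pos.1 (hs ⟨h0, h1⟩)
  rcases le_or_gt j n with hj | hj
  · rw [departure_eq fun i hi => h.1 i (by omega)] at hj2
    exact absurd (arrival_mono hσ (Nat.succ_le_succ hj)) (not_le.2 hj2)
  · exact absurd (h.2.trans_le (arrival_mono hτ hj)) (not_lt.2 hj1)

lemma busyLength_of_endsAt (hτ : ∀ k, 0 < τ k) (hσ : ∀ k, 0 < σ k) {n : ℕ}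
    (h : EndsAt τ σ n) : busyLength τ σ = ((n + 1 : ℕ) : ℕ∞) := by
  have : {k : ℕ | Set.Ico (serviceStart τ σ k) (departure τ σ k) ⊆ busyPeriod τ σ} =
      (Finset.range (n + 1) : Set ℕ) := by
    ext k
    simp only [Set.mem_ofPred_eq, Finset.coe_range, Set.mem_Iio]
    constructor
    · intro hk
      by_contra hn
      exact not_service_subset_busyPeriod hτ hσ h (by omega) hk
    · exact fun hk => service_subset_busyPeriod hσ fun j hj => h.1 j (by omega)
  rw [busyLength, this, Set.encard_coe_eq_coe_finsetCard, Finset.card_range]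

/-- Either some customer arrives after all earlier services, and the first such index determines the
length, or the period never ends and its length is infinite. -/
lemma busyLength_eq_iff (hτ : ∀ k, 0 < τ k) (hσ : ∀ k, 0 < σ k) (n : ℕ) :
    busyLength τ σ = ((n + 1 : ℕ) : ℕ∞) ↔ EndsAt τ σ n := by
  refine ⟨fun h => ?_, busyLength_of_endsAt hτ hσ⟩
  by_cases hex : ∃ k, arrival σ (k + 1) < arrival τ (k + 1)
  · have hf : EndsAt τ σ (Nat.find hex) :=
      ⟨fun k hk => not_lt.1 (Nat.find_min hex hk), Nat.find_spec hex⟩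
    have := busyLength_of_endsAt hτ hσ hf
    rw [h] at this
    have h2 : n + 1 = Nat.find hex + 1 := by exact_mod_cast this
    rwa [← Nat.succ_injective h2] at hf
  · push Not at hex
    have : {k : ℕ | Set.Ico (serviceStart τ σ k) (departure τ σ k) ⊆ busyPeriod τ σ} =
        Set.univ := Set.eq_univ_of_forall fun k => service_subset_busyPeriod hσ fun j _ => hex j
    rw [busyLength, this, Set.encard_univ, ENat.card_eq_top_of_infinite] at h
    exact absurd h.symm (ENat.natCast_ne_top _)

/-! ### Recursion on the first arrival -/

/-- The service requirements seen by the next customer, who arrives at time `t` during the first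
service: the remainder of that service is merged into the following one. -/
def mergeService {n : ℕ} (x : Fin (n + 2) → ℝ) (t : ℝ) : Fin (n + 1) → ℝ :=
  Fin.cons (x 0 - t + x 1) fun i => x i.succ.succ

/-- The event `EndsAt`, by recursion on the first arrival. -/
def EndsAtRec : (n : ℕ) → (Fin (n + 1) → ℝ) → (Fin (n + 1) → ℝ) → Prop
  | 0, t, x => x 0 < t 0
  | n + 1, t, x => t 0 ≤ x 0 ∧ EndsAtRec n (Fin.tail t) (mergeService x (t 0))

lemma arrival_succ' (τ : ℕ → ℝ) (k : ℕ) :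
    arrival τ (k + 1) = arrival (fun i => τ (i + 1)) k + τ 0 :=
  Finset.sum_range_succ' _ _

/-- Restarting the clock at the first arrival and merging services shifts the partial sums on both
sides by `τ 0`, so all remaining comparisons are preserved. -/
lemma endsAt_iff_endsAtRec (τ σ : ℕ → ℝ) (n : ℕ) :
    EndsAt τ σ n ↔ EndsAtRec n (fun i => τ i) (fun i => σ i) := by
  induction n generalizing τ σ with
  | zero => simp [EndsAt, EndsAtRec, arrival]
  | succ n ih =>
    set σ' : ℕ → ℝ := fun i => Nat.casesOn i (σ 0 - τ 0 + σ 1) fun j => σ (j + 2) with hσ'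
    have h1 : mergeService (fun i : Fin (n + 2) => σ i) (τ 0) = fun i : Fin (n + 1) => σ' i := by
      funext i
      refine Fin.cases ?_ (fun j => ?_) i
      · simp [mergeService, hσ']
      · simp [mergeService, hσ']
    have h2 : ∀ k, arrival σ' (k + 1) = arrival σ (k + 2) - τ 0 := by
      intro k
      rw [arrival_succ', arrival_succ' σ, arrival_succ' (fun i => σ (i + 1))]
      change arrival (fun i => σ (i + 2)) k + (σ 0 - τ 0 + σ 1) =
        arrival (fun i => σ (i + 2)) k + σ 1 + σ 0 - τ 0
      ring
    have h3 : ∀ k, arrival (fun i => τ (i + 1)) (k + 1) = arrival τ (k + 2) - τ 0 := by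
      intro k
      rw [arrival_succ' τ]
      ring
    have h4 : Fin.tail (fun i : Fin (n + 2) => τ i) = fun i : Fin (n + 1) => τ (i + 1) := by
      funext i
      simp [Fin.tail]
    have h5 : EndsAt τ σ (n + 1) ↔ τ 0 ≤ σ 0 ∧ EndsAt (fun i => τ (i + 1)) σ' n := by
      simp only [EndsAt, h2, h3, sub_le_sub_iff_right, sub_lt_sub_iff_right]
      constructor
      · rintro ⟨ha, hb⟩
        exact ⟨by simpa [arrival] using ha 0 (by omega), fun k hk => ha (k + 1) (by omega), hb⟩
      · rintro ⟨ha, hb, hc⟩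
        refine ⟨?_, hc⟩
        rintro (_ | k) hk
        · simpa [arrival] using ha
        · exact hb k (by omega)
    rw [h5, ih]
    simp only [EndsAtRec, h4, Fin.val_zero, h1]

lemma measurableSet_endsAtRec (n : ℕ) :
    MeasurableSet {p : (Fin (n + 1) → ℝ) × (Fin (n + 1) → ℝ) | EndsAtRec n p.1 p.2} := by
  induction n with
  | zero =>
    simp only [EndsAtRec]
    exact measurableSet_lt (by fun_prop) (by fun_prop)
  | succ n ih =>
    have hm : Measurable fun p : (Fin (n + 2) → ℝ) × (Fin (n + 2) → ℝ) =>
        ((Fin.tail p.1 : Fin (n + 1) → ℝ), mergeService p.2 (p.1 0)) := by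
      refine Measurable.prodMk (measurable_pi_lambda _ fun i => ?_)
        (measurable_pi_lambda _ fun i => ?_)
      · simp only [Fin.tail]; fun_prop
      · refine Fin.cases ?_ (fun j => ?_) i
        · simp only [mergeService, Fin.cons_zero]; fun_prop
        · simp only [mergeService, Fin.cons_succ]; fun_prop
    simp only [EndsAtRec]
    have h0 : MeasurableSet {p : (Fin (n + 2) → ℝ) × (Fin (n + 2) → ℝ) | p.1 0 ≤ p.2 0} :=
      measurableSet_le (by fun_prop) (by fun_prop)
    exact h0.inter (hm ih)

end SamplePath

end MM1

namespace MM1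

/-! ### Exponential and gamma laws -/

section Gamma

open Real

/-- The density on `(0, ∞)` of the sum of `k + 1` independent `Exp(r)` variables. -/
noncomputable def erlangDensity (k : ℕ) (r t : ℝ) : ℝ :=
  r ^ (k + 1) / k.factorial * t ^ k * exp (-(r * t))

@[fun_prop]
lemma measurable_erlangDensity (k : ℕ) (r : ℝ) : Measurable (erlangDensity k r) := by
  unfold erlangDensity
  fun_prop

lemma erlangDensity_nonneg (k : ℕ) {r t : ℝ} (hr : 0 ≤ r) (ht : 0 ≤ t) :
    0 ≤ erlangDensity k r t := by
  unfold erlangDensity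
  positivity

/-- The Erlang law: the gamma law with integral shape `k + 1`. -/
noncomputable def erlangMeasure (k : ℕ) (r : ℝ) : Measure ℝ :=
  (volume.restrict (Set.Ioi 0)).withDensity fun t => ENNReal.ofReal (erlangDensity k r t)

lemma expMeasure_eq_erlangMeasure (r : ℝ) : expMeasure r = erlangMeasure 0 r := by
  rw [erlangMeasure, ← withDensity_indicator measurableSet_Ioi, expMeasure, gammaMeasure]
  refine withDensity_congr_ae ?_
  -- The two densities may disagree at `0`, since `gammaPDF` is supported on `[0, ∞)`.
  filter_upwards [compl_mem_ae_iff.2 (measure_singleton (0 : ℝ))] with t ht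
  rcases lt_or_gt_of_ne (show t ≠ 0 from ht) with h | h
  · rw [gammaPDF_of_neg h, Set.indicator_of_notMem (by simpa using h.le)]
  · rw [gammaPDF_of_nonneg h.le, Set.indicator_of_mem (by simpa using h)]
    simp [erlangDensity]

lemma lintegral_expMeasure (r : ℝ) {f : ℝ → ENNReal} (hf : Measurable f) :
    ∫⁻ t, f t ∂(expMeasure r) =
      ∫⁻ t in Set.Ioi 0, ENNReal.ofReal (r * exp (-(r * t))) * f t := by
  rw [expMeasure_eq_erlangMeasure, erlangMeasure,
    lintegral_withDensity_eq_lintegral_mul _ (by fun_prop) hf]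
  simp [erlangDensity]

lemma ae_pos_expMeasure (r : ℝ) : ∀ᵐ t ∂(expMeasure r), 0 < t := by
  rw [expMeasure_eq_erlangMeasure]
  exact (withDensity_absolutelyContinuous _ _).ae_le (ae_restrict_mem measurableSet_Ioi)

lemma lintegral_Ioc_ofReal {f : ℝ → ℝ} {a : ℝ} (ha : 0 ≤ a) (hf : Continuous f)
    (h0 : ∀ t ∈ Set.Ioc 0 a, 0 ≤ f t) :
    ∫⁻ t in Set.Ioc 0 a, ENNReal.ofReal (f t) = ENNReal.ofReal (∫ t in (0 : ℝ)..a, f t) := by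
  rw [intervalIntegral.integral_of_le ha, ofReal_integral_eq_lintegral_ofReal]
  · exact (hf.integrableOn_Icc).mono_set Set.Ioc_subset_Icc_self
  · exact (ae_restrict_iff' measurableSet_Ioc).2 (Filter.Eventually.of_forall h0)

lemma integral_sub_pow (a : ℝ) (k : ℕ) :
    ∫ t in (0 : ℝ)..a, (a - t) ^ k = a ^ (k + 1) / (k + 1) := by
  rw [intervalIntegral.integral_comp_sub_left (fun u => u ^ k)]
  simp

/-- The exponentials multiply to `exp (-(r * x))`, free of the integration variable, so only the
power `(x - y) ^ k` is integrated. -/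
lemma expMeasure_conv_erlangMeasure {r : ℝ} (hr : 0 < r) (k : ℕ) :
    expMeasure r ∗ erlangMeasure k r = erlangMeasure (k + 1) r := by
  rw [expMeasure_eq_erlangMeasure]
  simp only [erlangMeasure, ← withDensity_indicator measurableSet_Ioi]
  have hm : ∀ k, Measurable ((Set.Ioi 0).indicator
      fun t => ENNReal.ofReal (erlangDensity k r t)) :=
    fun k => Measurable.indicator (by fun_prop) measurableSet_Ioi
  rw [conv_withDensity_eq_lconvolution (hm _) (hm _)]
  congr 1
  funext x
  rw [lconvolution_def]
  have h1 : ∀ y, (Set.Ioi 0).indicator (fun t => ENNReal.ofReal (erlangDensity 0 r t)) y *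
      (Set.Ioi 0).indicator (fun t => ENNReal.ofReal (erlangDensity k r t)) (-y + x) =
      (Set.Ioo 0 x).indicator (fun y => ENNReal.ofReal
        (r ^ (k + 2) / k.factorial * exp (-(r * x)) * (x - y) ^ k)) y := by
    intro y
    by_cases hy : 0 < y
    · by_cases hyx : y < x
      · rw [Set.indicator_of_mem (by simpa using hy), Set.indicator_of_mem (by simpa using hyx),
          Set.indicator_of_mem (by exact ⟨hy, hyx⟩),
          ← ENNReal.ofReal_mul (erlangDensity_nonneg _ hr.le hy.le)]
        congr 1
        have : exp (-(r * x)) = exp (-(r * y)) * exp (-(r * (-y + x))) := by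
          rw [← exp_add]; congr 1; ring
        rw [this]
        simp only [erlangDensity, Nat.factorial_zero, Nat.cast_one]
        ring
      · rw [Set.indicator_of_notMem (s := Set.Ioi 0) (a := -y + x) (by simpa using hyx),
          Set.indicator_of_notMem (s := Set.Ioo 0 x) (fun h => hyx h.2), mul_zero]
    · rw [Set.indicator_of_notMem (s := Set.Ioi 0) (a := y) (by simpa using hy),
        Set.indicator_of_notMem (s := Set.Ioo 0 x) (fun h => hy h.1), zero_mul]
  rw [lintegral_congr h1, lintegral_indicator measurableSet_Ioo]
  rcases le_or_gt x 0 with hx | hx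
  · rw [Set.Ioo_eq_empty (not_lt.2 hx), Set.indicator_of_notMem (by simpa using hx)]
    simp
  · rw [Set.indicator_of_mem (by simpa using hx), setLIntegral_congr Ioo_ae_eq_Ioc,
      lintegral_Ioc_ofReal hx.le (by fun_prop), intervalIntegral.integral_const_mul,
      integral_sub_pow]
    · congr 1
      rw [erlangDensity, Nat.factorial_succ]
      push_cast
      field_simp
    · intro t ht
      have : 0 ≤ x - t := by linarith [ht.2]
      positivity

/-! ### Sums of exponentials are Erlang -/

lemma expSumLaw_zero (r : ℝ) : expSumLaw r 0 = Measure.dirac 0 := by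
  rw [expSumLaw, Measure.pi_of_empty _ 0, Measure.map_dirac' (by fun_prop)]
  simp

lemma expSumLaw_succ {r : ℝ} (hr : 0 < r) (k : ℕ) :
    expSumLaw r (k + 1) = expMeasure r ∗ expSumLaw r k := by
  have := isProbabilityMeasure_expMeasure hr
  have hmp := measurePreserving_piFinSuccAbove (fun _ : Fin (k + 1) => expMeasure r) 0
  have hs : Measurable fun x : Fin k → ℝ => ∑ i, x i := by fun_prop
  have h1 := Measure.map_prod_map (expMeasure r) (Measure.pi fun _ : Fin k => expMeasure r)
    measurable_id hs
  rw [Measure.map_id] at h1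
  rw [expSumLaw, expSumLaw, Measure.conv, h1, ← hmp.map_eq, Measure.map_map (by fun_prop),
    Measure.map_map (by fun_prop) (MeasurableEquiv.measurable _)]
  · congr 1
    funext x
    simp [Fin.sum_univ_succ, Fin.tail, MeasurableEquiv.piFinSuccAbove]
  · exact (measurable_id.prodMap hs)

lemma expSumLaw_succ_eq {r : ℝ} (hr : 0 < r) (k : ℕ) :
    expSumLaw r (k + 1) = erlangMeasure k r := by
  have := isProbabilityMeasure_expMeasure hr
  induction k with
  | zero =>
    rw [expSumLaw_succ hr, expSumLaw_zero, Measure.conv_dirac_zero, expMeasure_eq_erlangMeasure]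
  | succ k ih => rw [expSumLaw_succ hr, ih, expMeasure_conv_erlangMeasure hr]

lemma isProbabilityMeasure_expSumLaw {r : ℝ} (hr : 0 < r) (k : ℕ) :
    IsProbabilityMeasure (expSumLaw r k) := by
  have := isProbabilityMeasure_expMeasure hr
  exact Measure.isProbabilityMeasure_map (by fun_prop)

/-- Tilting `Exp(mu)` by a Poisson weight gives a multiple of an Erlang law. -/
lemma expMeasure_withDensity_poisson {lam mu : ℝ} (hlam : 0 < lam) (hmu : 0 < mu) (k : ℕ) :
    (expMeasure mu).withDensity
        (fun t => ENNReal.ofReal (exp (-(lam * t)) * ((lam * t) ^ k / k.factorial))) =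
      ENNReal.ofReal (lam ^ k * mu / (lam + mu) ^ (k + 1)) • expSumLaw (lam + mu) (k + 1) := by
  have hs : 0 < lam + mu := by positivity
  rw [expSumLaw_succ_eq hs, erlangMeasure, expMeasure_eq_erlangMeasure, erlangMeasure,
    ← withDensity_mul _ (by fun_prop) (by fun_prop), ← withDensity_smul _ (by fun_prop)]
  refine withDensity_congr_ae ((ae_restrict_iff' measurableSet_Ioi).2 (.of_forall ?_))
  intro t ht
  have ht : 0 < t := ht
  rw [Pi.mul_apply, Pi.smul_apply, smul_eq_mul,
    ← ENNReal.ofReal_mul (erlangDensity_nonneg _ hmu.le ht.le),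
    ← ENNReal.ofReal_mul (by positivity)]
  congr 1
  have : exp (-((lam + mu) * t)) = exp (-(lam * t)) * exp (-(mu * t)) := by
    rw [← exp_add]; congr 1; ring
  simp only [erlangDensity, this, Nat.factorial_zero, Nat.cast_one]
  field_simp
  ring

lemma lintegral_pi_prod {ι : Type*} [Fintype ι] {ν : ι → Measure ℝ}
    [∀ i, IsProbabilityMeasure (ν i)] {f : ι → ℝ → ENNReal} (hf : ∀ i, Measurable (f i)) :
    ∫⁻ x, ∏ i, f i (x i) ∂(Measure.pi ν) = ∏ i, ∫⁻ t, f i t ∂(ν i) := by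
  have hi : iIndepFun (fun i (x : ι → ℝ) => f i (x i)) (Measure.pi ν) :=
    iIndepFun_pi fun i => (hf i).aemeasurable
  rw [lintegral_prod_eq_prod_lintegral_of_indepFun Finset.univ _ hi fun i => by fun_prop]
  refine Finset.prod_congr rfl fun i _ => ?_
  exact (measurePreserving_eval ν i).lintegral_comp (hf i)

/-- Measures are compared on boxes, whose indicators factor over the coordinates. Finiteness of `c
i` keeps the factors finite, as uniqueness of the product measure requires. -/
lemma pi_withDensity_prod {ι : Type*} [Fintype ι] {ν ρ : ι → Measure ℝ}
    [∀ i, IsProbabilityMeasure (ν i)] [∀ i, IsProbabilityMeasure (ρ i)]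
    {f : ι → ℝ → ENNReal} (hf : ∀ i, Measurable (f i)) {c : ι → ENNReal} (hc : ∀ i, c i ≠ ⊤)
    (h : ∀ i, (ν i).withDensity (f i) = c i • ρ i) :
    (Measure.pi ν).withDensity (fun x => ∏ i, f i (x i)) = (∏ i, c i) • Measure.pi ρ := by
  have : ∀ i, IsFiniteMeasure (c i • ρ i) := fun i => Measure.smul_finite _ (hc i)
  have h1 : Measure.pi (fun i => c i • ρ i) = (∏ i, c i) • Measure.pi ρ :=
    Measure.pi_eq fun s _ => by
      simp [Measure.pi_pi, Finset.prod_mul_distrib]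
  rw [← h1]
  symm
  refine Measure.pi_eq fun s hs => ?_
  rw [withDensity_apply _ (MeasurableSet.univ_pi hs),
    ← lintegral_indicator (MeasurableSet.univ_pi hs)]
  have h2 : ∀ x : ι → ℝ, (Set.univ.pi s).indicator (fun x => ∏ i, f i (x i)) x =
      ∏ i, (s i).indicator (f i) (x i) := by
    intro x
    by_cases hx : ∀ i, x i ∈ s i
    · rw [Set.indicator_of_mem (by simpa [Set.mem_pi] using hx)]
      exact Finset.prod_congr rfl fun i _ => (Set.indicator_of_mem (hx i) _).symm
    · rw [Set.indicator_of_notMem (by simpa [Set.mem_pi] using hx)]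
      push Not at hx
      obtain ⟨i, hi⟩ := hx
      exact (Finset.prod_eq_zero (Finset.mem_univ i) (Set.indicator_of_notMem hi _)).symm
  rw [lintegral_congr h2, lintegral_pi_prod fun i => (hf i).indicator (hs i)]
  refine Finset.prod_congr rfl fun i _ => ?_
  rw [lintegral_indicator (hs i), ← withDensity_apply _ (hs i), h]

end Gamma

end MM1

namespace MM1

/-! ### The probability of the event `EndsAt` given the service times -/

section Density

open Real

/-- The monomial `∏ x_j ^ r_j / r_j!` attached to a sequence of run lengths. -/
noncomputable def runWeight {n : ℕ} (r : List ℕ) (x : Fin n → ℝ) : ℝ :=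
  ∏ j, x j ^ r.getD j 0 / (r.getD j 0).factorial

lemma runWeight_cons {n : ℕ} (a : ℕ) (r : List ℕ) (x : Fin (n + 1) → ℝ) :
    runWeight (a :: r) x = x 0 ^ a / a.factorial * runWeight r (Fin.tail x) := by
  rw [runWeight, Fin.prod_univ_succ]
  rfl

lemma runWeight_nonneg {n : ℕ} (r : List ℕ) {x : Fin n → ℝ} (hx : ∀ i, 0 ≤ x i) :
    0 ≤ runWeight r x :=
  Finset.prod_nonneg fun i _ => div_nonneg (pow_nonneg (hx i) _) (Nat.cast_nonneg _)

lemma tail_mergeService {n : ℕ} (x : Fin (n + 2) → ℝ) (t : ℝ) :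
    Fin.tail (mergeService x t) = Fin.tail (Fin.tail x) := rfl

lemma sum_mergeService {n : ℕ} (x : Fin (n + 2) → ℝ) (t : ℝ) :
    ∑ i, mergeService x t i = ∑ i, x i - t := by
  rw [Fin.sum_univ_succ, Fin.sum_univ_succ x, Fin.sum_univ_succ (fun i => x (Fin.succ i))]
  simp only [mergeService, Fin.cons_zero, Fin.cons_succ, Fin.succ_zero_eq_one]
  ring

lemma mergeService_nonneg {n : ℕ} {x : Fin (n + 2) → ℝ} (hx : ∀ i, 0 ≤ x i) {t : ℝ}
    (ht : t ≤ x 0) (i : Fin (n + 1)) : 0 ≤ mergeService x t i := by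
  refine Fin.cases ?_ (fun j => hx _) i
  have := hx 1
  simp only [mergeService, Fin.cons_zero]
  linarith

/-- With divided powers the binomial coefficients disappear, leaving the same antidiagonal sum as in
`sum_runSeqs_succ`. -/
lemma add_pow_div_factorial (a b : ℝ) (k : ℕ) :
    (a + b) ^ k / k.factorial =
      ∑ p ∈ Finset.HasAntidiagonal.antidiagonal k,
        a ^ p.1 / p.1.factorial * (b ^ p.2 / p.2.factorial) := by
  rw [(Commute.all a b).add_pow', Finset.sum_div]
  refine Finset.sum_congr rfl fun p hp => ?_
  rw [Finset.HasAntidiagonal.mem_antidiagonal] at hp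
  subst hp
  have h := Nat.add_choose_mul_factorial_mul_factorial p.1 p.2
  rw [Nat.choose_symm_add.symm] at h
  have h' : (((p.1 + p.2).choose p.1 : ℕ) : ℝ) * p.1.factorial * p.2.factorial =
      (p.1 + p.2).factorial := by
    exact_mod_cast h
  rw [nsmul_eq_mul, ← h']
  have h1 : (((p.1 + p.2).choose p.1 : ℕ) : ℝ) ≠ 0 :=
    Nat.cast_ne_zero.2 (Nat.choose_pos (by omega)).ne'
  field_simp

lemma continuous_runWeight_mergeService {n : ℕ} (r : List ℕ) (x : Fin (n + 2) → ℝ) :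
    Continuous fun t => runWeight r (mergeService x t) := by
  unfold runWeight
  refine continuous_finsetProd _ fun j _ => ?_
  refine Fin.cases ?_ (fun j => ?_) j
  · simp only [mergeService, Fin.cons_zero]; fun_prop
  · simp only [mergeService, Fin.cons_succ]; fun_prop

/-- Expanding the merged power in `x 0 - t` and `x 1`, integration turns `(x 0 - t) ^ a / a!` into
`x 0 ^ (a + 1) / (a + 1)!`: the first run regains its deleted up step. -/
lemma integral_sum_runWeight {n : ℕ} (x : Fin (n + 2) → ℝ) :
    ∫ t in (0 : ℝ)..x 0, ∑ r ∈ runSeqs n, runWeight r (mergeService x t) =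
      ∑ r ∈ runSeqs (n + 1), runWeight r x := by
  rw [sum_runSeqs_succ, intervalIntegral.integral_finsetSum
    fun r _ => (continuous_runWeight_mergeService r x).intervalIntegrable _ _]
  refine Finset.sum_congr rfl fun r hr => ?_
  obtain ⟨c, r, rfl⟩ : ∃ a r', r = a :: r' :=
    List.exists_cons_of_length_eq_add_one (mem_runSeqs.1 hr).1
  simp only [List.headD_cons, List.tail_cons, runWeight_cons, tail_mergeService]
  have h1 : ∀ t, mergeService x t 0 = (x 0 - t) + x 1 := fun t => rfl
  simp only [h1, add_pow_div_factorial, Finset.sum_mul]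
  rw [intervalIntegral.integral_finsetSum
    fun p _ => Continuous.intervalIntegrable (by fun_prop) _ _]
  refine Finset.sum_congr rfl fun p _ => ?_
  rw [intervalIntegral.integral_mul_const, intervalIntegral.integral_mul_const,
    intervalIntegral.integral_div, integral_sub_pow, Nat.factorial_succ]
  push_cast
  rw [div_div]
  simp only [Fin.tail, Fin.succ_zero_eq_one, mul_assoc]

lemma expMeasure_Ioi {r : ℝ} (hr : 0 < r) {a : ℝ} (ha : 0 ≤ a) :
    expMeasure r (Set.Ioi a) = ENNReal.ofReal (exp (-(r * a))) := by
  have := isProbabilityMeasure_expMeasure hr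
  rw [← Set.compl_Iic, prob_compl_eq_one_sub measurableSet_Iic, ← ofReal_cdf,
    cdf_expMeasure_eq hr, if_pos ha, ← ENNReal.ofReal_one, ← ENNReal.ofReal_sub]
  · congr 1; ring
  · rw [sub_nonneg, exp_le_one_iff]
    nlinarith

/-- Given the service times `x`, the probability that the busy period ends with customer `n`. -/
theorem pi_endsAtRec {lam : ℝ} (hlam : 0 < lam) (n : ℕ) {x : Fin (n + 1) → ℝ}
    (hx : ∀ i, 0 ≤ x i) :
    Measure.pi (fun _ : Fin (n + 1) => expMeasure lam) {t | EndsAtRec n t x} =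
      ENNReal.ofReal
        (lam ^ n * exp (-(lam * ∑ i, x i)) * ∑ r ∈ runSeqs n, runWeight r x) := by
  have := isProbabilityMeasure_expMeasure hlam
  induction n with
  | zero =>
    have h1 := (measurePreserving_eval (fun _ : Fin 1 => expMeasure lam) 0).measure_preimage
      (measurableSet_Ioi (a := x 0)).nullMeasurableSet
    rw [expMeasure_Ioi hlam (hx 0)] at h1
    have h2 : {t | EndsAtRec 0 t x} = Function.eval (0 : Fin 1) ⁻¹' Set.Ioi (x 0) := rfl
    rw [h2, h1]
    simp [runSeqs_zero, runWeight]
  | succ n ih =>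
    -- Condition on the first inter-arrival time; beyond `x 0` the event is empty, otherwise the
    -- induction hypothesis applies to the merged services.
    have hmp := measurePreserving_piFinSuccAbove (fun _ : Fin (n + 2) => expMeasure lam) 0
    set S : Set (ℝ × (Fin (n + 1) → ℝ)) :=
      {q | q.1 ≤ x 0 ∧ EndsAtRec n q.2 (mergeService x q.1)} with hS
    have hSm : MeasurableSet S := by
      have h0 : MeasurableSet {q : ℝ × (Fin (n + 1) → ℝ) | q.1 ≤ x 0} :=
        measurableSet_le (by fun_prop) (by fun_prop)
      have hm : Measurable fun q : ℝ × (Fin (n + 1) → ℝ) => (q.2, mergeService x q.1) := by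
        refine Measurable.prodMk (by fun_prop) (measurable_pi_lambda _ fun i => ?_)
        refine Fin.cases ?_ (fun j => ?_) i
        · simp only [mergeService, Fin.cons_zero]; fun_prop
        · simp only [mergeService, Fin.cons_succ]; fun_prop
      exact h0.inter (hm (measurableSet_endsAtRec n))
    have hpre : {t | EndsAtRec (n + 1) t x} =
        MeasurableEquiv.piFinSuccAbove (fun _ : Fin (n + 2) => ℝ) 0 ⁻¹' S := by
      ext t
      simp [hS, EndsAtRec, MeasurableEquiv.piFinSuccAbove]
    rw [hpre, hmp.measure_preimage hSm.nullMeasurableSet, Measure.prod_apply hSm]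
    set G : ℝ → ℝ := fun t =>
      lam ^ n * exp (-(lam * (∑ i, x i - t))) * ∑ r ∈ runSeqs n, runWeight r (mergeService x t)
      with hG
    have hGc : Continuous G := by
      have := fun r => continuous_runWeight_mergeService r x
      fun_prop
    have hG0 : ∀ t ≤ x 0, 0 ≤ G t := fun t ht =>
      mul_nonneg (by positivity) (Finset.sum_nonneg fun r _ =>
        runWeight_nonneg r (mergeService_nonneg hx ht))
    have h1 : ∀ t, (Measure.pi fun _ : Fin (n + 1) => expMeasure lam) (Prod.mk t ⁻¹' S) =
        (Set.Iic (x 0)).indicator (fun t => ENNReal.ofReal (G t)) t := by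
      intro t
      by_cases ht : t ≤ x 0
      · have h2 : Prod.mk t ⁻¹' S = {t' | EndsAtRec n t' (mergeService x t)} := by
          ext t'; simp [hS, ht]
        rw [Set.indicator_of_mem (by simpa using ht), h2, ih (mergeService_nonneg hx ht),
          sum_mergeService]
      · have h2 : Prod.mk t ⁻¹' S = ∅ := by
          ext t'; simp [hS, ht]
        rw [Set.indicator_of_notMem (by simpa using ht), h2, measure_empty]
    have hGm : Measurable fun t => ENNReal.ofReal (G t) := hGc.measurable.ennreal_ofReal
    rw [lintegral_congr h1, lintegral_expMeasure _ (hGm.indicator measurableSet_Iic)]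
    have h3 : ∀ t, ENNReal.ofReal (lam * exp (-(lam * t))) *
        (Set.Iic (x 0)).indicator (fun t => ENNReal.ofReal (G t)) t =
        (Set.Iic (x 0)).indicator
          (fun t => ENNReal.ofReal (lam * exp (-(lam * t)) * G t)) t := by
      intro t
      by_cases ht : t ∈ Set.Iic (x 0)
      · rw [Set.indicator_of_mem ht, Set.indicator_of_mem ht,
          ← ENNReal.ofReal_mul (by positivity)]
      · rw [Set.indicator_of_notMem ht, Set.indicator_of_notMem ht, mul_zero]
    rw [lintegral_congr h3, setLIntegral_indicator measurableSet_Iic, Set.inter_comm,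
      Set.Ioi_inter_Iic, lintegral_Ioc_ofReal (hx 0) (by fun_prop)
        fun t ht => mul_nonneg (by positivity) (hG0 t ht.2)]
    congr 1
    rw [← integral_sum_runWeight, ← intervalIntegral.integral_const_mul]
    refine intervalIntegral.integral_congr fun t _ => ?_
    -- The density of the first arrival restores the factor lost when merging shortened the total
    -- service by `t`.
    have h4 : exp (-(lam * ∑ i, x i)) = exp (-(lam * t)) * exp (-(lam * (∑ i, x i - t))) := by
      rw [← exp_add]; congr 1; ring
    simp only [hG, h4]
    ring

end Density

/-! ### Laplace transforms -/

section Laplace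

lemma integral_exp_expMeasure {r : ℝ} (hr : 0 < r) {s : ℂ} (hs : 0 ≤ s.re) :
    ∫ t, Complex.exp (-s * (t : ℂ)) ∂(expMeasure r) = (r : ℂ) / (r + s) := by
  have hre : (-((r : ℂ) + s)).re < 0 := by simp; linarith
  rw [expMeasure_eq_erlangMeasure, erlangMeasure,
    integral_withDensity_eq_integral_toReal_smul (by fun_prop) (by simp)]
  have h1 : ∀ t ∈ Set.Ioi (0 : ℝ), (ENNReal.ofReal (erlangDensity 0 r t)).toReal •
      Complex.exp (-s * (t : ℂ)) = (r : ℂ) * Complex.exp (-((r : ℂ) + s) * t) := by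
    intro t ht
    rw [ENNReal.toReal_ofReal (erlangDensity_nonneg _ hr.le (le_of_lt ht))]
    have : Complex.exp (-((r : ℂ) + s) * t) =
        Complex.exp (-(r * t)) * Complex.exp (-s * t) := by
      rw [← Complex.exp_add]; congr 1; ring
    rw [this]
    simp [erlangDensity, mul_assoc]
  rw [setIntegral_congr_fun measurableSet_Ioi h1, integral_const_mul,
    integral_exp_mul_complex_Ioi hre]
  simp only [Complex.ofReal_zero, mul_zero, Complex.exp_zero]
  rw [neg_div_neg_eq, mul_one_div]

lemma integral_exp_expSumLaw {r : ℝ} (hr : 0 < r) {s : ℂ} (hs : 0 ≤ s.re) (k : ℕ) :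
    ∫ t, Complex.exp (-s * (t : ℂ)) ∂(expSumLaw r k) = ((r : ℂ) / (r + s)) ^ k := by
  have := isProbabilityMeasure_expMeasure hr
  rw [expSumLaw, integral_map (by fun_prop)
    (Continuous.aestronglyMeasurable (by fun_prop))]
  simp only [Complex.ofReal_sum, Finset.mul_sum, Complex.exp_sum]
  rw [integral_fintype_prod_eq_prod (fun (_ : Fin k) t => Complex.exp (-s * ((t : ℝ) : ℂ)))]
  simp only [integral_exp_expMeasure hr hs, Finset.prod_const, Finset.card_univ, Fintype.card_fin]

lemma ae_nonneg_expSumLaw {r : ℝ} (hr : 0 < r) (k : ℕ) : ∀ᵐ t ∂(expSumLaw r k), 0 ≤ t := by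
  have := isProbabilityMeasure_expMeasure hr
  rw [expSumLaw, ae_map_iff (by fun_prop) measurableSet_Ici]
  have : ∀ᵐ x ∂(Measure.pi fun _ : Fin k => expMeasure r), ∀ i, 0 < x i :=
    ae_all_iff.2 fun i =>
      (measurePreserving_eval (fun _ : Fin k => expMeasure r) i).quasiMeasurePreserving.ae
        (ae_pos_expMeasure r)
  filter_upwards [this] with x hx using Finset.sum_nonneg fun i _ => (hx i).le

lemma integrable_exp_expSumLaw {r : ℝ} (hr : 0 < r) {s : ℂ} (hs : 0 ≤ s.re) (k : ℕ) :
    Integrable (fun t : ℝ => Complex.exp (-s * (t : ℂ))) (expSumLaw r k) := by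
  have := isProbabilityMeasure_expSumLaw hr k
  refine Integrable.of_bound (Continuous.aestronglyMeasurable (by fun_prop)) 1 ?_
  filter_upwards [ae_nonneg_expSumLaw hr k] with t ht
  rw [Complex.norm_exp, Real.exp_le_one_iff]
  simp only [Complex.mul_re, Complex.neg_re, Complex.ofReal_re, Complex.ofReal_im, mul_zero,
    sub_zero]
  nlinarith

end Laplace

end MM1

namespace MM1

/-! ### The conditional law of the service times -/

section Law

/-- By Fubini, the probability of the event given the services is the density, relative to their
product law, of their law on that event. -/
lemma map_snd_restrict_prod {α β : Type*} [MeasurableSpace α] [MeasurableSpace β]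
    (ρ : Measure α) (ν : Measure β) [SFinite ρ] [SFinite ν] {E : Set (α × β)}
    (hE : MeasurableSet E) :
    ((ρ.prod ν).restrict E).map Prod.snd = ν.withDensity fun y => ρ {x | (x, y) ∈ E} := by
  ext B hB
  rw [Measure.map_apply measurable_snd hB, Measure.restrict_apply (measurable_snd hB),
    Measure.prod_apply_symm ((measurable_snd hB).inter hE), withDensity_apply _ hB,
    ← lintegral_indicator hB]
  refine lintegral_congr fun y => ?_
  by_cases hy : y ∈ B
  · rw [Set.indicator_of_mem hy]
    congr 1
    ext x
    simp [hy]
  · rw [Set.indicator_of_notMem hy]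
    convert! measure_empty (μ := ρ)
    ext x
    simp [hy]

lemma map_prodMk_eq_prod {Ω : Type*} [MeasurableSpace Ω] {P : Measure Ω}
    [IsProbabilityMeasure P] {lam mu : ℝ} (hlam : 0 < lam) (hmu : 0 < mu) {τ σ : ℕ → Ω → ℝ}
    (hτ : ∀ k, HasLaw (τ k) (expMeasure lam) P) (hσ : ∀ k, HasLaw (σ k) (expMeasure mu) P)
    (hind : iIndepFun (Sum.elim τ σ) P) (n : ℕ) :
    P.map (fun ω => ((fun i : Fin n => τ i ω), (fun i : Fin n => σ i ω))) =
      (Measure.pi fun _ => expMeasure lam).prod (Measure.pi fun _ => expMeasure mu) := by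
  have h1 := isProbabilityMeasure_expMeasure hlam
  have h2 := isProbabilityMeasure_expMeasure hmu
  have hinj : Function.Injective (Sum.map Fin.val Fin.val : Fin n ⊕ Fin n → ℕ ⊕ ℕ) :=
    Sum.map_injective.2 ⟨Fin.val_injective, Fin.val_injective⟩
  have hae : ∀ i : Fin n ⊕ Fin n, AEMeasurable (Sum.elim τ σ (Sum.map Fin.val Fin.val i)) P := by
    rintro (i | i)
    · exact (hτ i).aemeasurable
    · exact (hσ i).aemeasurable
  have hpi := (hind.precomp hinj).map_fun_eq_pi_map hae
  set ν : Fin n ⊕ Fin n → Measure ℝ := Sum.elim (fun _ => expMeasure lam) fun _ => expMeasure mu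
    with hν
  have hlaw : (fun i : Fin n ⊕ Fin n => P.map (Sum.elim τ σ (Sum.map Fin.val Fin.val i))) = ν := by
    funext i
    rcases i with i | i
    · exact (hτ i).map_eq
    · exact (hσ i).map_eq
  have hprob : ∀ i, IsProbabilityMeasure (ν i) := by
    rintro (i | i)
    · exact h1
    · exact h2
  rw [hlaw] at hpi
  have hmp := (measurePreserving_sumPiEquivProdPi (X := fun _ => ℝ) ν).map_eq
  rw [← hpi, AEMeasurable.map_map_of_aemeasurable (MeasurableEquiv.measurable _).aemeasurable
    (aemeasurable_pi_lambda _ hae)] at hmp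
  exact hmp

/-- The common weight of all Dyck paths of length `2 * n`. -/
noncomputable def pathProb (lam mu : ℝ) (n : ℕ) : ENNReal :=
  ENNReal.ofReal (lam ^ n * mu ^ (n + 1) / (lam + mu) ^ (2 * n + 1))

lemma sum_getD_eq_sum {n : ℕ} {l : List ℕ} (hl : l.length = n) :
    ∑ j : Fin n, l.getD j 0 = l.sum := by
  subst hl
  induction l with
  | nil => rfl
  | cons a l ih =>
    rw [List.sum_cons, ← ih]
    exact Fin.sum_univ_succ _

lemma sum_getD_runs {n : ℕ} (π : DyckPath n) :
    ∑ j : Fin (n + 1), (runs π.1.toList).getD j 0 = n := by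
  obtain ⟨h1, h2, -⟩ := mem_runSeqs.1 (Finset.mem_image_of_mem _ (Finset.mem_univ π))
  rw [sum_getD_eq_sum h1, h2]

/-- The run lengths sum to `n` for every path, so the product does not depend on the path; this is
the source of uniformity. -/
lemma prod_weight_eq_pathProb {lam mu : ℝ} (hlam : 0 < lam) (hmu : 0 < mu) {n : ℕ}
    (π : DyckPath n) :
    ∏ j : Fin (n + 1), ENNReal.ofReal (lam ^ (runs π.1.toList).getD j 0 * mu /
      (lam + mu) ^ ((runs π.1.toList).getD j 0 + 1)) = pathProb lam mu n := by
  rw [← ENNReal.ofReal_prod_of_nonneg fun i _ => by positivity, pathProb]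
  congr 1
  rw [Finset.prod_div_distrib, Finset.prod_mul_distrib, Finset.prod_pow_eq_pow_sum,
    Finset.prod_pow_eq_pow_sum, Finset.sum_add_distrib, sum_getD_runs]
  simp
  ring_nf

/-- The joint law of the service times on the event that the busy period ends with
customer `n`. -/
lemma withDensity_endsAtRec {lam mu : ℝ} (hlam : 0 < lam) (hmu : 0 < mu) (n : ℕ) :
    (Measure.pi fun _ : Fin (n + 1) => expMeasure mu).withDensity
        (fun x => Measure.pi (fun _ : Fin (n + 1) => expMeasure lam) {t | EndsAtRec n t x}) =
      pathProb lam mu n •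
        ∑ π : DyckPath n, Measure.pi fun j => expSumLaw (lam + mu) (numExp π j) := by
  have h1 := isProbabilityMeasure_expMeasure hmu
  have hpos : ∀ᵐ x ∂(Measure.pi fun _ : Fin (n + 1) => expMeasure mu), ∀ i, 0 < x i :=
    ae_all_iff.2 fun i =>
      (measurePreserving_eval (fun _ : Fin (n + 1) => expMeasure mu) i).quasiMeasurePreserving.ae
        (ae_pos_expMeasure mu)
  -- Since the runs sum to `n`, both `lam ^ n` and the exponential can be distributed over the
  -- coordinates.
  have hdens : (fun x => Measure.pi (fun _ : Fin (n + 1) => expMeasure lam)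
      {t | EndsAtRec n t x}) =ᵐ[Measure.pi fun _ : Fin (n + 1) => expMeasure mu]
      fun x => ∑ π : DyckPath n, ∏ j : Fin (n + 1), ENNReal.ofReal (Real.exp (-(lam * x j)) *
        ((lam * x j) ^ (runs π.1.toList).getD j 0 /
          ((runs π.1.toList).getD j 0).factorial)) := by
    filter_upwards [hpos] with x hx
    rw [pi_endsAtRec hlam n fun i => (hx i).le, sum_runSeqs, Finset.mul_sum,
      ENNReal.ofReal_sum_of_nonneg fun π _ => mul_nonneg (by positivity)
        (runWeight_nonneg _ fun i => (hx i).le)]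
    refine Finset.sum_congr rfl fun π _ => ?_
    rw [← ENNReal.ofReal_prod_of_nonneg fun i _ => by have := hx i; positivity]
    congr 1
    simp only [mul_pow, mul_div_assoc]
    rw [Finset.prod_mul_distrib, Finset.prod_mul_distrib, Finset.prod_pow_eq_pow_sum,
      sum_getD_runs, ← Real.exp_sum, Finset.sum_neg_distrib, ← Finset.mul_sum, runWeight]
    ring
  rw [withDensity_congr_ae hdens]
  have hm : ∀ π : DyckPath n, Measurable fun x : Fin (n + 1) → ℝ =>
      ∏ j : Fin (n + 1), ENNReal.ofReal (Real.exp (-(lam * x j)) *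
        ((lam * x j) ^ (runs π.1.toList).getD j 0 /
          ((runs π.1.toList).getD j 0).factorial)) := by
    intro π
    fun_prop
  have hsum : (fun x : Fin (n + 1) → ℝ => ∑ π : DyckPath n, ∏ j : Fin (n + 1),
      ENNReal.ofReal (Real.exp (-(lam * x j)) * ((lam * x j) ^ (runs π.1.toList).getD j 0 /
          ((runs π.1.toList).getD j 0).factorial))) =
      ∑ π : DyckPath n, fun x => ∏ j : Fin (n + 1),
      ENNReal.ofReal (Real.exp (-(lam * x j)) * ((lam * x j) ^ (runs π.1.toList).getD j 0 /
          ((runs π.1.toList).getD j 0).factorial)) := by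
    funext x
    simp
  have hfin : ∀ (s : Finset (DyckPath n)) (f : DyckPath n → (Fin (n + 1) → ℝ) → ENNReal),
      (∀ π, Measurable (f π)) →
      (Measure.pi fun _ : Fin (n + 1) => expMeasure mu).withDensity (∑ π ∈ s, f π) =
      ∑ π ∈ s, (Measure.pi fun _ : Fin (n + 1) => expMeasure mu).withDensity (f π) := by
    intro s f hf
    classical
    induction s using Finset.induction_on with
    | empty => simp
    | insert π s hs ih =>
      rw [Finset.sum_insert hs, Finset.sum_insert hs, withDensity_add_left (hf π), ih]
  rw [hsum, hfin _ _ hm, Finset.smul_sum]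
  refine Finset.sum_congr rfl fun π _ => ?_
  have h2 : ∀ j, IsProbabilityMeasure (expSumLaw (lam + mu) (numExp π j)) :=
    fun j => isProbabilityMeasure_expSumLaw (by positivity) _
  rw [pi_withDensity_prod (ν := fun _ => expMeasure mu)
    (ρ := fun j => expSumLaw (lam + mu) (numExp π j))
    (f := fun j t => ENNReal.ofReal (Real.exp (-(lam * t)) *
        ((lam * t) ^ (runs π.1.toList).getD j 0 / ((runs π.1.toList).getD j 0).factorial)))
    (c := fun j => ENNReal.ofReal (lam ^ (runs π.1.toList).getD j 0 * mu /
      (lam + mu) ^ ((runs π.1.toList).getD j 0 + 1)))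
    (fun j => by fun_prop) (fun j => ENNReal.ofReal_ne_top)
    (fun j => by rw [numExp_eq, expMeasure_withDensity_poisson hlam hmu]),
    prod_weight_eq_pathProb hlam hmu]

variable {Ω : Type*} [MeasurableSpace Ω] {P : Measure Ω} [IsProbabilityMeasure P] {lam mu : ℝ}
  {τ σ : ℕ → Ω → ℝ}

lemma map_restrict_busyLength (hlam : 0 < lam) (hmu : 0 < mu)
    (hτ : ∀ k, HasLaw (τ k) (expMeasure lam) P) (hσ : ∀ k, HasLaw (σ k) (expMeasure mu) P)
    (hind : iIndepFun (Sum.elim τ σ) P) (n : ℕ) :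
    (P.restrict {ω | busyLength (fun k => τ k ω) (fun k => σ k ω) = ((n + 1 : ℕ) : ℕ∞)}).map
        (fun ω (i : Fin (n + 1)) => σ i ω) =
      pathProb lam mu n •
        ∑ π : DyckPath n, Measure.pi fun j => expSumLaw (lam + mu) (numExp π j) := by
  have hl := isProbabilityMeasure_expMeasure hlam
  have hm := isProbabilityMeasure_expMeasure hmu
  set Z : Ω → (Fin (n + 1) → ℝ) × (Fin (n + 1) → ℝ) :=
    fun ω => ((fun i => τ i ω), (fun i => σ i ω)) with hZ
  have hZm : AEMeasurable Z P :=
    AEMeasurable.prodMk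
      (aemeasurable_pi_lambda (fun ω (i : Fin (n + 1)) => τ i ω) fun i => (hτ i).aemeasurable)
      (aemeasurable_pi_lambda (fun ω (i : Fin (n + 1)) => σ i ω) fun i => (hσ i).aemeasurable)
  have hE := measurableSet_endsAtRec n
  have hτ0 : ∀ᵐ ω ∂P, ∀ k, 0 < τ k ω := ae_all_iff.2 fun k =>
    ae_of_ae_map (hτ k).aemeasurable (by rw [(hτ k).map_eq]; exact ae_pos_expMeasure lam)
  have hσ0 : ∀ᵐ ω ∂P, ∀ k, 0 < σ k ω := ae_all_iff.2 fun k =>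
    ae_of_ae_map (hσ k).aemeasurable (by rw [(hσ k).map_eq]; exact ae_pos_expMeasure mu)
  -- Almost sure positivity of all times replaces the busy-period event by the preimage of a
  -- measurable set.
  have hset : {ω | busyLength (fun k => τ k ω) (fun k => σ k ω) = ((n + 1 : ℕ) : ℕ∞)} =ᵐ[P]
      Z ⁻¹' {p | EndsAtRec n p.1 p.2} := by
    filter_upwards [hτ0, hσ0] with ω h1 h2
    exact propext ((busyLength_eq_iff h1 h2 n).trans (endsAt_iff_endsAtRec _ _ n))
  have hZmap := map_prodMk_eq_prod hlam hmu hτ hσ hind (n + 1)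
  rw [Measure.restrict_congr_set hset,
    show (fun ω (i : Fin (n + 1)) => σ i ω) = Prod.snd ∘ Z from rfl,
    ← AEMeasurable.map_map_of_aemeasurable measurable_snd.aemeasurable hZm.restrict,
    ← Measure.restrict_map_of_aemeasurable hZm hE, hZmap, map_snd_restrict_prod _ _ hE]
  exact withDensity_endsAtRec hlam hmu n

lemma serviceLaw_eq (hlam : 0 < lam) (hmu : 0 < mu)
    (hτ : ∀ k, HasLaw (τ k) (expMeasure lam) P) (hσ : ∀ k, HasLaw (σ k) (expMeasure mu) P)
    (hind : iIndepFun (Sum.elim τ σ) P) (n : ℕ) :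
    serviceLaw P τ σ n = (catalan n : ENNReal)⁻¹ •
      ∑ π : DyckPath n, Measure.pi fun j => expSumLaw (lam + mu) (numExp π j) := by
  have h := map_restrict_busyLength hlam hmu hτ hσ hind n
  have hp : ∀ k, IsProbabilityMeasure (expSumLaw (lam + mu) k) :=
    isProbabilityMeasure_expSumLaw (by positivity)
  have hσm : AEMeasurable (fun ω (i : Fin (n + 1)) => σ i ω) P :=
    aemeasurable_pi_lambda _ fun i => (hσ i).aemeasurable
  -- Taking total masses, the conditioning event has probability `pathProb` times the number of Dyck
  -- paths; normalising cancels `pathProb`.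
  have hP := congrArg (fun m => m Set.univ) h
  simp only [Measure.map_apply_of_aemeasurable hσm.restrict MeasurableSet.univ, Set.preimage_univ,
    Measure.restrict_apply_univ, Measure.smul_apply, Measure.finsetSum_apply, measure_univ,
    Finset.sum_const, Finset.card_univ, card_dyckPath, nsmul_eq_mul, mul_one, smul_eq_mul] at hP
  have h0 : pathProb lam mu n ≠ 0 := by
    rw [pathProb, ne_eq, ENNReal.ofReal_eq_zero, not_le]
    positivity
  have ht : pathProb lam mu n ≠ ⊤ := ENNReal.ofReal_ne_top
  rw [serviceLaw, ProbabilityTheory.cond, Measure.map_smul, h, hP, smul_smul,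
    ENNReal.mul_inv (.inl h0) (.inl ht), mul_right_comm, ENNReal.inv_mul_cancel h0 ht, one_mul]

lemma prod_pow_numExp {n : ℕ} (π : DyckPath n) (z : Fin (n + 1) → ℂ) :
    ∏ j, z j ^ numExp π j =
      (∏ i : Fin n, z i.castSucc) * (∏ i : Fin n, z i.castSucc ^ alpha π i) * z (Fin.last n) := by
  rw [Fin.prod_univ_castSucc, ← Finset.prod_mul_distrib]
  simp [numExp, pow_succ']

end Law

end MM1

/-! ### The Laplace transform as an average over Dyck paths -/

theorem corollary1 {Ω : Type*} [MeasurableSpace Ω] (P : Measure Ω) [IsProbabilityMeasure P]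
    (lam mu : ℝ) (hlam : 0 < lam) (hstab : lam < mu)
    (τ σ : ℕ → Ω → ℝ)
    (hτ : ∀ k, HasLaw (τ k) (expMeasure lam) P)
    (hσ : ∀ k, HasLaw (σ k) (expMeasure mu) P)
    (hind : iIndepFun (Sum.elim τ σ) P)
    (n : ℕ) :
    (∀ s z : Fin (n + 1) → ℂ, (∀ i, 0 ≤ (s i).re) →
      (∀ i, z i = ((lam : ℂ) + mu) / ((lam : ℂ) + mu + s i)) →
      Integrable (fun x : Fin (n + 1) → ℝ => ∏ i, Complex.exp (-(s i) * (x i : ℂ)))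
          (MM1.serviceLaw P τ σ n) ∧
        ∫ x, ∏ i, Complex.exp (-(s i) * (x i : ℂ)) ∂(MM1.serviceLaw P τ σ n) =
          1 / (catalan n : ℂ) * (∏ i : Fin n, z i.castSucc) *
            MvPolynomial.eval (fun i : Fin n => z i.castSucc) (MM1.dyckR n) * z (Fin.last n)) ∧
    MM1.serviceLaw P τ σ n =
      (catalan n : ENNReal)⁻¹ •
        ∑ π : MM1.DyckPath n,
          Measure.pi (fun j : Fin (n + 1) => MM1.expSumLaw (lam + mu) (MM1.numExp π j)) := by
  have hmu : 0 < mu := hlam.trans hstab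
  have hr : 0 < lam + mu := add_pos hlam hmu
  have hlaw := MM1.serviceLaw_eq hlam hmu hτ hσ hind n
  refine ⟨fun s z hs hz => ?_, hlaw⟩
  have hp := MM1.isProbabilityMeasure_expSumLaw hr
  have hint : ∀ π : MM1.DyckPath n, Integrable
      (fun x : Fin (n + 1) → ℝ => ∏ i, Complex.exp (-(s i) * (x i : ℂ)))
      (Measure.pi fun j => MM1.expSumLaw (lam + mu) (MM1.numExp π j)) := fun π =>
    Integrable.fintype_prod_dep fun i => MM1.integrable_exp_expSumLaw hr (hs i) _
  -- For a fixed path the coordinates are independent, and `z j` is the transform of a single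
  -- `Exp(lam + mu)` summand.
  have hval : ∀ π : MM1.DyckPath n,
      ∫ x : Fin (n + 1) → ℝ, ∏ i, Complex.exp (-(s i) * (x i : ℂ))
        ∂(Measure.pi fun j => MM1.expSumLaw (lam + mu) (MM1.numExp π j)) =
      ∏ j, z j ^ MM1.numExp π j := by
    intro π
    rw [integral_fintype_prod_eq_prod fun i (t : ℝ) => Complex.exp (-(s i) * (t : ℂ))]
    refine Finset.prod_congr rfl fun i _ => ?_
    rw [MM1.integral_exp_expSumLaw hr (hs i), hz, Complex.ofReal_add]
  have hc : (catalan n : ENNReal) ≠ 0 := by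
    intro h
    have h1 := succ_mul_catalan_eq_centralBinom n
    rw [Nat.cast_eq_zero.1 h, mul_zero] at h1
    exact n.centralBinom_ne_zero h1.symm
  rw [hlaw]
  refine ⟨Integrable.smul_measure (integrable_finsetSum_measure.2 fun π _ => hint π)
    (ENNReal.inv_ne_top.2 hc), ?_⟩
  rw [integral_smul_measure, integral_finsetSum_measure fun π _ => hint π]
  simp only [hval, MM1.prod_pow_numExp, MM1.dyckR, map_sum, map_prod, map_pow,
    MvPolynomial.eval_X, ENNReal.toReal_inv, ENNReal.toReal_natCast, one_div]
  rw [← Finset.sum_mul, ← Finset.mul_sum, Complex.real_smul]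
  push_cast
  ring
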